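/- **Setting.** Work in the real vector space of self-adjoint matrices in $M_2\otimes M_2\otimes M_2$ (three-qubit self-adjoint matrices, subsystems $A,B,C$), written as $8\times 8$ matrices with respect to the lexicographic order of indices. Let $\alpha$, $\beta$, $\gamma$ be the convex cones generated by the pure product states $|\xi\rangle\langle\xi|$ for the bipartitions $A$-$BC$, $B$-$CA$, $C$-$AB$ respectively (the un-normalized $A$-$BC$, $B$-$CA$, $C$-$AB$ separable states). For a convex cone $\sigma$ let $\sigma^\circ$ be the dual cone of all self-adjoint $W$ with $\langle \varrho,W\rangle=\operatorname{tr}(\varrho W^{\mathrm t})\ge 0$ for all $\varrho\in\sigma$. Write $\sigma\wedge\tau$ for the intersection and $\sigma\vee\tau$ for the convex hull of the union (that is, the sum $\sigma+\tau$). For $s,t\in\mathbb R^4$ and $u\in\mathbb C^4$ let $X(s,t,u)$ be the self-adjoint $8\times 8$ matrix with diagonal $(s_1,s_2,s_3,s_4,t_4,t_3,t_2,t_1)$, with anti-diagonal $(u_1,u_2,u_3,u_4,\bar u_4,\bar u_3,\bar u_2,\bar u_1)$ read from the top right to the bottom left corner, and with all other entries zero. The X-part of $W$ is obtained by replacing all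 entries off the diagonal and the anti-diagonal by zero; $W$ is X-shaped if it equals its X-part. A pair $\{i,j\}$ is an unordered set of two different elements of $\{1,2,3,4\}$, and $\{k,\ell\}$ denotes its complement. For $s_i,t_i\ge 0$ consider the following inequalities: - $W_1[i,j]$: $\ \sqrt{s_it_i}+\sqrt{s_jt_j}\ge |u_i|+|u_j|$; - $W_2[i,j]$: $\ \sum_{m\ne j}\sqrt{s_mt_m}\ge |u_i|$ and $\sum_{m\neq i}\sqrt{s_mt_m}\ge |u_j|$; - $W_3$: $\ \sum_{m=1}^4\sqrt{s_mt_m}\ge\sum_{m=1}^4|u_m|$; - $W_4[i,j]$: $\ \sqrt{s_it_i}+\sqrt{s_jt_j}+2\min\{\sqrt{s_kt_k},\sqrt{s_\ell t_\ell}\}\ge |u_i|+|u_j|$ and $\sqrt{s_it_i}+\sqrt{s_jt_j}+2(\sqrt{s_kt_k}+\sqrt{s_\ell t_\ell})\ge |u_i|+|u_j|+2\max\{|u_k|,|u_\ell|\}$. **Theorem 5.1.** Let $W$ be a three-qubit self-adjoint matrix with X-part $X(s,t,u)$. 1. If $W\in(\alpha^\circ\wedge\beta^\circ)\vee(\alpha^\circ\wedge\gamma^\circ)$,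 then $s_i,t_i\ge0$ for all $i$, and $W_1[1,4]$, $W_1[2,3]$, $W_3$ hold, as well as $W_2[i,j]$ and $W_4[i,j]$ for every pair $\{i,j\}$. 2. If $W\in(\beta^\circ\wedge\gamma^\circ)\vee(\beta^\circ\wedge\alpha^\circ)$, then $s_i,t_i\ge0$ for all $i$, and $W_1[1,3]$, $W_1[2,4]$, $W_3$ hold, as well as $W_2[i,j]$ and $W_4[i,j]$ for every pair $\{i,j\}$. 3. If $W\in(\gamma^\circ\wedge\alpha^\circ)\vee(\gamma^\circ\wedge\beta^\circ)$, then $s_i,t_i\ge0$ for all $i$, and $W_1[1,2]$, $W_1[3,4]$, $W_3$ hold, as well as $W_2[i,j]$ and $W_4[i,j]$ for every pair $\{i,j\}$. If $W$ is X-shaped, then the converse of each of 1, 2 and 3 also holds. -/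

import Mathlib

namespace ThreeQubit

/-- The index set of the standard product basis of `ℂ² ⊗ ℂ² ⊗ ℂ²`: the triple `(i, j, k)` is the
basis vector `|i⟩ ⊗ |j⟩ ⊗ |k⟩`, with the subsystems `A`, `B`, `C` in this order. -/
abbrev Idx : Type := Fin 2 × Fin 2 × Fin 2

/-- The 64-dimensional real vector space of self-adjoint three-qubit matrices. -/
abbrev Herm : Type := selfAdjoint (Matrix Idx Idx ℂ)

/-- The (unnormalized) pure state `|ξ⟩⟨ξ|` of a vector `ξ`. -/
def pureState (ξ : Idx → ℂ) : Matrix Idx Idx ℂ := Matrix.vecMulVec ξ (star ξ)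

/-- `α`: the convex cone generated by the pure product states `|x ⊗ y⟩⟨x ⊗ y|` with `x` in the
space of `A` and `y` in the space of `BC`. -/
noncomputable def coneA : PointedCone ℝ Herm :=
  PointedCone.hull ℝ {ρ : Herm | ∃ (x : Fin 2 → ℂ) (y : Fin 2 × Fin 2 → ℂ),
    (ρ : Matrix Idx Idx ℂ) = pureState (fun p => x p.1 * y (p.2.1, p.2.2))}

/-- `β`: the same for `x` in the space of `B` and `y` in the space of `CA`. -/
noncomputable def coneB : PointedCone ℝ Herm :=
  PointedCone.hull ℝ {ρ : Herm | ∃ (x : Fin 2 → ℂ) (y : Fin 2 × Fin 2 → ℂ),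
    (ρ : Matrix Idx Idx ℂ) = pureState (fun p => x p.2.1 * y (p.2.2, p.1))}

/-- `γ`: the same for `x` in the space of `C` and `y` in the space of `AB`. -/
noncomputable def coneC : PointedCone ℝ Herm :=
  PointedCone.hull ℝ {ρ : Herm | ∃ (x : Fin 2 → ℂ) (y : Fin 2 × Fin 2 → ℂ),
    (ρ : Matrix Idx Idx ℂ) = pureState (fun p => x p.2.2 * y (p.1, p.2.1))}

/-- The bilinear pairing `⟨x, y⟩ = tr (x yᵀ)` on self-adjoint matrices (its value is real,
see `pairing_eq_trace`). -/
noncomputable def pairing : Herm →ₗ[ℝ] Herm →ₗ[ℝ] ℝ :=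
  LinearMap.mk₂ ℝ
    (fun x y => ((x : Matrix Idx Idx ℂ) * (y : Matrix Idx Idx ℂ).transpose).trace.re)
    (by intro a b c; simp [add_mul])
    (by intro r a b; simp)
    (by intro a b c; simp [mul_add])
    (by intro r a b; simp)

theorem pairing_eq_trace (x y : Herm) :
    ((pairing x y : ℝ) : ℂ) =
      ((x : Matrix Idx Idx ℂ) * (y : Matrix Idx Idx ℂ).transpose).trace := by
  have hx : Matrix.conjTranspose (x : Matrix Idx Idx ℂ) = x := x.2
  have hy : Matrix.conjTranspose (y : Matrix Idx Idx ℂ) = y := y.2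
  have hyt : Matrix.conjTranspose (y : Matrix Idx Idx ℂ).transpose =
      (y : Matrix Idx Idx ℂ).transpose := by
    ext i j
    exact congrFun (congrFun hy j) i
  refine Complex.conj_eq_iff_re.mp ?_
  have h := Matrix.trace_conjTranspose
    ((x : Matrix Idx Idx ℂ) * (y : Matrix Idx Idx ℂ).transpose)
  rw [Matrix.conjTranspose_mul, hx, hyt, Matrix.trace_mul_comm] at h
  exact h.symm

/-- The dual cone `C° = {W | ⟨ρ, W⟩ ≥ 0 for all ρ ∈ C}`. -/
noncomputable def dualCone (C : PointedCone ℝ Herm) : PointedCone ℝ Herm :=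
  PointedCone.dual pairing (C : Set Herm)

/-- The basis vectors `000, 001, 010, 011`, i.e. the first half of the lexicographic order. The
indices `1, 2, 3, 4` of `X(s,t,u)` are represented by `0, 1, 2, 3 : Fin 4`. -/
def lo : Fin 4 → Idx := ![(0, 0, 0), (0, 0, 1), (0, 1, 0), (0, 1, 1)]

/-- The index on the anti-diagonal opposite to `p`: all three bits are flipped. -/
def flipBits (p : Idx) : Idx := (1 - p.1, 1 - p.2.1, 1 - p.2.2)

/-- The self-adjoint matrix `X(s,t,u)`: in lexicographic order its diagonal is
`s₁, s₂, s₃, s₄, t₄, t₃, t₂, t₁`, its anti-diagonal from the top right corner to the bottom left one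
is `u₁, u₂, u₃, u₄, ū₄, ū₃, ū₂, ū₁`, and the other entries are zero. -/
def xMatrix (s t : Fin 4 → ℝ) (u : Fin 4 → ℂ) : Matrix Idx Idx ℂ :=
  ∑ i, (Matrix.single (lo i) (lo i) (s i : ℂ)
    + Matrix.single (flipBits (lo i)) (flipBits (lo i)) (t i : ℂ)
    + Matrix.single (lo i) (flipBits (lo i)) (u i)
    + Matrix.single (flipBits (lo i)) (lo i) (star (u i)))

/-- The `X`-part of a matrix: only the diagonal and anti-diagonal entries are kept. -/
def xPart (M : Matrix Idx Idx ℂ) : Matrix Idx Idx ℂ :=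
  Matrix.of fun p q => if q = p ∨ q = flipBits p then M p q else 0

/-- A matrix is `X`-shaped if all entries off the diagonal and the anti-diagonal vanish. -/
def IsXShaped (M : Matrix Idx Idx ℂ) : Prop :=
  ∀ p q, q ≠ p → q ≠ flipBits p → M p q = 0

/-- `√(sᵢ tᵢ)`. -/
noncomputable def gm (s t : Fin 4 → ℝ) (i : Fin 4) : ℝ := Real.sqrt (s i * t i)

/-- The inequality `W₁[i,j]`. -/
def W1 (s t : Fin 4 → ℝ) (u : Fin 4 → ℂ) (i j : Fin 4) : Prop :=
  gm s t i + gm s t j ≥ ‖u i‖ + ‖u j‖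

/-- The inequalities `W₂[i,j]`. -/
def W2 (s t : Fin 4 → ℝ) (u : Fin 4 → ℂ) (i j : Fin 4) : Prop :=
  (∑ k ∈ Finset.univ.erase j, gm s t k) ≥ ‖u i‖ ∧ (∑ k ∈ Finset.univ.erase i, gm s t k) ≥ ‖u j‖

/-- The inequality `W₃`. -/
def W3 (s t : Fin 4 → ℝ) (u : Fin 4 → ℂ) : Prop :=
  ∑ i, gm s t i ≥ ∑ i, ‖u i‖

/-- The inequalities `W₄[i,j]` for a pair `{i,j}`, where `{k,l}` is the complementary pair. -/
def W4 (s t : Fin 4 → ℝ) (u : Fin 4 → ℂ) (i j : Fin 4) : Prop :=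
  ∀ k l : Fin 4, ({i, j, k, l} : Finset (Fin 4)) = Finset.univ →
    gm s t i + gm s t j + 2 * min (gm s t k) (gm s t l) ≥ ‖u i‖ + ‖u j‖ ∧
    gm s t i + gm s t j + 2 * (gm s t k + gm s t l) ≥ ‖u i‖ + ‖u j‖ + 2 * max ‖u k‖ ‖u l‖

/-- All `sᵢ` and `tᵢ` are nonnegative (so that the square roots `√(sᵢ tᵢ)` make sense) and the
inequalities `W₃`, `W₂[i,j]`, `W₄[i,j]` hold for every pair `{i,j}`. -/
def CommonIneqs (s t : Fin 4 → ℝ) (u : Fin 4 → ℂ) : Prop :=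
  (∀ i, 0 ≤ s i ∧ 0 ≤ t i) ∧ W3 s t u ∧ ∀ i j, i ≠ j → W2 s t u i j ∧ W4 s t u i j

/-- The criterion of the version for `α`. -/
def CritA (s t : Fin 4 → ℝ) (u : Fin 4 → ℂ) : Prop :=
  CommonIneqs s t u ∧ W1 s t u 0 3 ∧ W1 s t u 1 2

/-- The criterion of the version for `β`. -/
def CritB (s t : Fin 4 → ℝ) (u : Fin 4 → ℂ) : Prop :=
  CommonIneqs s t u ∧ W1 s t u 0 2 ∧ W1 s t u 1 3

/-- The criterion of the version for `γ`. -/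
def CritC (s t : Fin 4 → ℝ) (u : Fin 4 → ℂ) : Prop :=
  CommonIneqs s t u ∧ W1 s t u 0 1 ∧ W1 s t u 2 3

end ThreeQubit

/-! The proof reduces the theorem to linear inequalities in the numbers `m i = √(sᵢ tᵢ)` and
`n i = |uᵢ|`.

Membership of `W` in the dual of a cone of product states means nonnegativity of the form
`ξ ↦ ⟨|ξ⟩⟨ξ|, W⟩` on product vectors. Write `ī` for the index with all bits flipped. For product
vectors of a given bipartition, `ξ_i ξ_ī = ξ_j ξ_j̄` holds for the pairs `{i, j}` of a partition of the
four indices into two pairs: `{03, 12}` for `A`-`BC`, `{02, 13}` for `B`-`CA`, `{01, 23}` for `C`-`AB`.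
Hence, for `X`-shaped `W`, the inequality of arithmetic and geometric means shows that
`n i + n j ≤ m i + m j` for the two pairs suffices (`form_xMatrix_nonneg`). Conversely, for any `W` in
the dual cone these inequalities hold for its `X`-part: they follow by testing on product vectors
supported at `i`, `j`, `ī`, `j̄` and averaging over a sign that removes the other entries
(`W1_of_form_nonneg`). So each dual cone is described by two pairs (`DetectedByPairs`).

For a sum `W = V + V'`, the numbers `√(sᵢ tᵢ)` are superadditive and the numbers `|uᵢ|` are
subadditive, so the criterion follows from linear combinations of the pair inequalities of `V` and
`V'` (`splitIneqs_of_add`). For the converse, `m` and `n` have to be split into two nonnegative parts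
satisfying the respective pair inequalities; scaling the entries of `X(s,t,u)` then splits the matrix
accordingly. The splitting only involves the differences `d i = p i - q i ∈ [-n i, m i]` of the first
parts `p`, `q`, and eliminating `d 3`, `d 2`, `d 1`, `d 0` from the resulting linear
system leaves only consequences of the criterion (`SplitIneqs.exists_split`). The three
versions differ by a cyclic permutation of the three partitions into pairs. -/

namespace ThreeQubit

/-! ### The linear program -/

/-- The elimination step for one variable in a finite system of linear inequalities. -/
theorem exists_between_lists (L U : List ℝ) (h : ∀ l ∈ L, ∀ u ∈ U, l ≤ u) :
    ∃ x, (∀ l ∈ L, l ≤ x) ∧ ∀ u ∈ U, x ≤ u := by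
  induction L with
  | nil =>
    induction U with
    | nil => exact ⟨0, by simp⟩
    | cons v U ih =>
      obtain ⟨x, -, hx⟩ := ih (by simp)
      refine ⟨min v x, by simp, ?_⟩
      simp only [List.forall_mem_cons]
      exact ⟨min_le_left _ _, fun u hu => (min_le_right _ _).trans (hx u hu)⟩
  | cons v L ih =>
    simp only [List.forall_mem_cons] at h
    obtain ⟨x, hl, hu⟩ := ih h.2
    refine ⟨max v x, ?_, fun u hu' => max_le (h.1 u hu') (hu u hu')⟩
    simp only [List.forall_mem_cons]
    exact ⟨le_max_left _ _, fun l hl' => (hl l hl').trans (le_max_right _ _)⟩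

/-- The inequalities `W₂`, `W₃`, `W₄` for all pairs, together with nonnegativity, written as linear
inequalities in `m i = √(sᵢ tᵢ)` and `n i = |uᵢ|`. Sums over complements are expressed by the total
sum, and a minimum or maximum over the complement of `{i, j}` by one inequality for each `k` in
it. -/
structure SplitIneqs (m n : Fin 4 → ℝ) : Prop where
  left_nonneg : ∀ i, 0 ≤ m i
  right_nonneg : ∀ i, 0 ≤ n i
  sum_le : ∑ k, n k ≤ ∑ k, m k
  two : ∀ i j, i ≠ j → n i + m j ≤ ∑ k, m k
  four_min : ∀ i j k, i ≠ j → i ≠ k → j ≠ k → n i + n j ≤ m i + m j + 2 * m k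
  four_max : ∀ i j k, i ≠ j → i ≠ k → j ≠ k →
    n i + n j + 2 * n k + m i + m j ≤ 2 * ∑ k, m k

set_option maxHeartbeats 1000000 in
/-- Feasibility of the linear program behind the converse direction. The unknown `d i` is the excess
`p i - q i` of a splitting `m = p + (m - p)`, `n = q + (n - q)`; it ranges over `[-n i, m i]`, and the
conditions on the two summands involve only `d`. -/
theorem SplitIneqs.exists_split {m n : Fin 4 → ℝ} (h : SplitIneqs m n)
    (h03 : n 0 + n 3 ≤ m 0 + m 3) (h12 : n 1 + n 2 ≤ m 1 + m 2) :
    ∃ d : Fin 4 → ℝ, (∀ i, -n i ≤ d i ∧ d i ≤ m i) ∧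
      (0 ≤ d 0 + d 3 ∧ d 0 + d 3 ≤ m 0 + m 3 - (n 0 + n 3)) ∧
      (0 ≤ d 1 + d 2 ∧ d 1 + d 2 ≤ m 1 + m 2 - (n 1 + n 2)) ∧
      (0 ≤ d 0 + d 2 ∧ 0 ≤ d 1 + d 3) ∧
      d 0 + d 1 ≤ m 0 + m 1 - (n 0 + n 1) ∧ d 2 + d 3 ≤ m 2 + m 3 - (n 2 + n 3) := by
  obtain ⟨hm, hn, hs, h2, h4, h5⟩ := h
  have e3 : Fin.succ (2 : Fin 3) = (3 : Fin 4) := rfl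
  simp only [Fin.sum_univ_four] at hs h2 h5
  simp [Fin.forall_fin_succ, e3] at hm hn h2 h4 h5
  suffices ∃ a b c d : ℝ, ((-n 0 ≤ a ∧ a ≤ m 0) ∧ (-n 1 ≤ b ∧ b ≤ m 1) ∧ (-n 2 ≤ c ∧ c ≤ m 2) ∧
      (-n 3 ≤ d ∧ d ≤ m 3)) ∧
      (0 ≤ a + d ∧ a + d ≤ m 0 + m 3 - (n 0 + n 3)) ∧
      (0 ≤ b + c ∧ b + c ≤ m 1 + m 2 - (n 1 + n 2)) ∧
      (0 ≤ a + c ∧ 0 ≤ b + d) ∧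
      a + b ≤ m 0 + m 1 - (n 0 + n 1) ∧ c + d ≤ m 2 + m 3 - (n 2 + n 3) by
    obtain ⟨a, b, c, d, h⟩ := this
    refine ⟨![a, b, c, d], ?_⟩
    simpa [Fin.forall_fin_succ, e3] using h
  generalize m 0 = m0 at *
  generalize m 1 = m1 at *
  generalize m 2 = m2 at *
  generalize m 3 = m3 at *
  generalize n 0 = n0 at *
  generalize n 1 = n1 at *
  generalize n 2 = n2 at *
  generalize n 3 = n3 at *
  -- Fourier–Motzkin elimination of `d`, `c`, `b`, `a`, in this order; each list below consists of
  -- the bounds that the elimination of the later variables leaves for the current one.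
  obtain ⟨a, hal, hau⟩ := exists_between_lists
    [-n0, -m3, -m2, -(m2 + m3 - (n2 + n3)) / 2, -(m2 + m3 - n2), -(m2 + m3 - n3),
      -(m2 + m3 - (n2 + n3)) - m1, -(m2 + m3 - (n2 + n3)) - (m1 + m2 - n1),
      -(m2 + m3 - (n2 + n3) + (m1 + m2 - (n1 + n2))) / 2,
      -n1 - (m1 + m2 - (n1 + n2)), -m2 - (m1 + m2 - (n1 + n2)), -m3 - (m1 + m2 - (n1 + n2)),
      -(m2 + m3 - (n2 + n3)) / 2 - (m1 + m2 - (n1 + n2)), -(m2 + m3 - n2) - (m1 + m2 - (n1 + n2)),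
      -(m2 + m3 - n3) - (m1 + m2 - (n1 + n2))]
    [m0, m0 + m3 - n0, m0 + m1 - n0, m0 + m1 - (n0 + n1) + m2, m0 + m1 - (n0 + n1) + m3,
      m0 + m1 - (n0 + n1) + (m2 + m3 - (n2 + n3)) / 2, m0 + m1 - (n0 + n1) + (m2 + m3 - n2),
      m0 + m1 - (n0 + n1) + (m2 + m3 - n3),
      m0 + m3 - (n0 + n3) + m1, m0 + m3 - (n0 + n3) + (m1 + m2 - n1),
      (m0 + m3 - (n0 + n3) + (m0 + m1 - (n0 + n1))) / 2] (by
    simp only [List.forall_mem_cons, List.not_mem_nil, false_imp_iff, implies_true, and_true]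
    and_intros <;> linarith)
  simp only [List.forall_mem_cons, List.not_mem_nil, false_imp_iff, implies_true, and_true] at hal hau
  obtain ⟨b, hbl, hbu⟩ := exists_between_lists
    [-n1, -m2, -m3, -(m2 + m3 - (n2 + n3)) / 2, -(m2 + m3 - n2), -(m2 + m3 - n3),
      -(m2 + m3 - (n2 + n3)) - a, a - (m0 + m3 - (n0 + n3))]
    [m1, m1 + m2 - n1, m0 + m1 - (n0 + n1) - a, a + (m1 + m2 - (n1 + n2))] (by
    simp only [List.forall_mem_cons, List.not_mem_nil, false_imp_iff, implies_true, and_true]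
    and_intros <;> linarith)
  simp only [List.forall_mem_cons, List.not_mem_nil, false_imp_iff, implies_true, and_true] at hbl hbu
  obtain ⟨c, hcl, hcu⟩ := exists_between_lists [-b, -a, -n2]
    [m1 + m2 - (n1 + n2) - b, m2, m2 + m3 - (n2 + n3) + a, m2 + m3 - (n2 + n3) + b, m2 + m3 - n2] (by
    simp only [List.forall_mem_cons, List.not_mem_nil, false_imp_iff, implies_true, and_true]
    and_intros <;> linarith)
  simp only [List.forall_mem_cons, List.not_mem_nil, false_imp_iff, implies_true, and_true] at hcl hcu
  obtain ⟨d, hdl, hdu⟩ := exists_between_lists [-a, -b, -n3]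
    [m0 + m3 - (n0 + n3) - a, m2 + m3 - (n2 + n3) - c, m3] (by
    simp only [List.forall_mem_cons, List.not_mem_nil, false_imp_iff, implies_true, and_true]
    and_intros <;> linarith)
  simp only [List.forall_mem_cons, List.not_mem_nil, false_imp_iff, implies_true, and_true] at hdl hdu
  refine ⟨a, b, c, d, ?_⟩
  and_intros <;> linarith

theorem SplitIneqs.comp_perm {m n : Fin 4 → ℝ} (h : SplitIneqs m n) (σ : Equiv.Perm (Fin 4)) :
    SplitIneqs (m ∘ σ) (n ∘ σ) := by
  have e : ∑ k, (m ∘ σ) k = ∑ k, m k := Equiv.sum_comp σ m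
  have e' : ∑ k, (n ∘ σ) k = ∑ k, n k := Equiv.sum_comp σ n
  refine ⟨fun i => h.left_nonneg _, fun i => h.right_nonneg _, ?_, ?_, ?_, ?_⟩
  · rw [e, e']; exact h.sum_le
  · intro i j hij
    rw [e]; exact h.two _ _ (σ.injective.ne hij)
  · intro i j k hij hik hjk
    exact h.four_min _ _ _ (σ.injective.ne hij) (σ.injective.ne hik) (σ.injective.ne hjk)
  · intro i j k hij hik hjk
    rw [e]
    exact h.four_max _ _ _ (σ.injective.ne hij) (σ.injective.ne hik) (σ.injective.ne hjk)

/-- The inequality `n i + n j ≤ m i + m j`. -/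
def PairLE (m n : Fin 4 → ℝ) (i j : Fin 4) : Prop := n i + n j ≤ m i + m j

/-- The splitting of `m` and `n` into two parts satisfying the inequalities of the first and second
respectively third partition of `{0, 1, 2, 3}` into pairs, in the numbering given by `σ`, where the
first partition is common to both parts. -/
theorem PairLE.split {m n : Fin 4 → ℝ} (h : SplitIneqs m n) (σ : Equiv.Perm (Fin 4))
    (h03 : PairLE m n (σ 0) (σ 3)) (h12 : PairLE m n (σ 1) (σ 2)) :
    ∃ p q : Fin 4 → ℝ, (∀ i, 0 ≤ p i ∧ p i ≤ m i) ∧ (∀ i, 0 ≤ q i ∧ q i ≤ n i) ∧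
      (PairLE p q (σ 0) (σ 3) ∧ PairLE p q (σ 1) (σ 2)) ∧
      (PairLE p q (σ 0) (σ 2) ∧ PairLE p q (σ 1) (σ 3)) ∧
      (PairLE (m - p) (n - q) (σ 0) (σ 3) ∧ PairLE (m - p) (n - q) (σ 1) (σ 2)) ∧
      PairLE (m - p) (n - q) (σ 0) (σ 1) ∧ PairLE (m - p) (n - q) (σ 2) (σ 3) := by
  obtain ⟨d, hd, ⟨h1, h2⟩, ⟨h3, h4⟩, ⟨h5, h6⟩, h7, h8⟩ := (h.comp_perm σ).exists_split h03 h12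
  have key : ∀ x : ℝ, max x 0 - max (-x) 0 = x := fun x => by
    rcases le_total x 0 with hx | hx
    · rw [max_eq_right hx, max_eq_left (by linarith)]; ring
    · rw [max_eq_left hx, max_eq_right (by linarith)]; ring
  have k0 := key (d 0)
  have k1 := key (d 1)
  have k2 := key (d 2)
  have k3 := key (d 3)
  simp only [Function.comp] at *
  -- Only the excess `p - q` matters, so its positive and negative parts serve as `p` and `q`.
  refine ⟨fun i => max (d (σ.symm i)) 0, fun i => max (-d (σ.symm i)) 0, ?_, ?_, ?_⟩
  · intro i
    have := (hd (σ.symm i)).2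
    rw [σ.apply_symm_apply] at this
    exact ⟨le_max_right _ _, max_le this (h.left_nonneg i)⟩
  · intro i
    have := (hd (σ.symm i)).1
    rw [σ.apply_symm_apply] at this
    exact ⟨le_max_right _ _, max_le (by linarith) (h.right_nonneg i)⟩
  · simp only [PairLE, Pi.sub_apply, σ.symm_apply_apply]
    and_intros <;> linarith

/-- The converse of `PairLE.split`, with inequalities in place of the additive decompositions. -/
theorem splitIneqs_of_add {m n p q p' q' : Fin 4 → ℝ} (σ : Equiv.Perm (Fin 4))
    (hn : ∀ i, 0 ≤ n i)
    (hp : ∀ i, 0 ≤ p i) (hq : ∀ i, 0 ≤ q i) (hp' : ∀ i, 0 ≤ p' i) (hq' : ∀ i, 0 ≤ q' i)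
    (hm : ∀ i, p i + p' i ≤ m i) (hn' : ∀ i, n i ≤ q i + q' i)
    (h03 : PairLE p q (σ 0) (σ 3)) (h12 : PairLE p q (σ 1) (σ 2))
    (h02 : PairLE p q (σ 0) (σ 2)) (h13 : PairLE p q (σ 1) (σ 3))
    (h03' : PairLE p' q' (σ 0) (σ 3)) (h12' : PairLE p' q' (σ 1) (σ 2))
    (h01' : PairLE p' q' (σ 0) (σ 1)) (h23' : PairLE p' q' (σ 2) (σ 3)) :
    SplitIneqs m n ∧ PairLE m n (σ 0) (σ 3) ∧ PairLE m n (σ 1) (σ 2) := by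
  have main : SplitIneqs (m ∘ σ) (n ∘ σ) ∧ PairLE (m ∘ σ) (n ∘ σ) 0 3 ∧
      PairLE (m ∘ σ) (n ∘ σ) 1 2 := by
    replace hp := fun i => hp (σ i)
    replace hq := fun i => hq (σ i)
    replace hp' := fun i => hp' (σ i)
    replace hq' := fun i => hq' (σ i)
    replace hm := fun i => hm (σ i)
    replace hn := fun i => hn (σ i)
    replace hn' := fun i => hn' (σ i)
    have hm0 : ∀ i, 0 ≤ m (σ i) := fun i => by linarith [hp i, hp' i, hm i]
    have e3 : Fin.succ (2 : Fin 3) = (3 : Fin 4) := rfl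
    simp only [PairLE] at *
    simp only [Function.comp]
    refine ⟨⟨hm0, hn, ?_, ?_, ?_, ?_⟩, ?_, ?_⟩
    all_goals try simp only [Fin.sum_univ_four]
    all_goals simp [Fin.forall_fin_succ, e3] at hp hq hp' hq' hm hn' ⊢
    all_goals and_intros <;> linarith
  refine ⟨?_, main.2⟩
  simpa [Function.comp_assoc] using main.1.comp_perm σ.symm

/-! ### The criterion as linear inequalities -/

theorem univ_fin_four_of_distinct : ∀ i j k : Fin 4, i ≠ j → i ≠ k → j ≠ k →
    ∃ l, ({i, j, k, l} : Finset (Fin 4)) = Finset.univ := by decide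

theorem distinct_of_univ_fin_four : ∀ i j k l : Fin 4,
    ({i, j, k, l} : Finset (Fin 4)) = Finset.univ →
    i ≠ j ∧ i ≠ k ∧ i ≠ l ∧ j ≠ k ∧ j ≠ l ∧ k ≠ l := by decide

theorem sum_of_univ_fin_four (f : Fin 4 → ℝ) {i j k l : Fin 4}
    (h : ({i, j, k, l} : Finset (Fin 4)) = Finset.univ) :
    ∑ x, f x = f i + f j + f k + f l := by
  obtain ⟨h1, h2, h3, h4, h5, h6⟩ := distinct_of_univ_fin_four i j k l h
  rw [← h, Finset.sum_insert (by simp [*]), Finset.sum_insert (by simp [*]),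
    Finset.sum_insert (by simp [*]), Finset.sum_singleton]
  ring

theorem commonIneqs_iff (s t : Fin 4 → ℝ) (u : Fin 4 → ℂ) :
    CommonIneqs s t u ↔
      (∀ i, 0 ≤ s i ∧ 0 ≤ t i) ∧ SplitIneqs (gm s t) (fun i => ‖u i‖) := by
  have he : ∀ j, ∑ k ∈ Finset.univ.erase j, gm s t k = ∑ k, gm s t k - gm s t j := fun j =>
    Finset.sum_erase_eq_sub (Finset.mem_univ j)
  constructor
  · rintro ⟨h0, h3, h24⟩
    refine ⟨h0, fun i => Real.sqrt_nonneg _, fun i => norm_nonneg _, h3, ?_, ?_, ?_⟩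
    · intro i j hij
      have := (h24 i j hij).1.1
      rw [he] at this
      linarith
    · intro i j k hij hik hjk
      obtain ⟨l, hl⟩ := univ_fin_four_of_distinct i j k hij hik hjk
      have := ((h24 i j hij).2 k l hl).1
      linarith [min_le_left (gm s t k) (gm s t l)]
    · intro i j k hij hik hjk
      obtain ⟨l, hl⟩ := univ_fin_four_of_distinct i j k hij hik hjk
      have := ((h24 i j hij).2 k l hl).2
      rw [sum_of_univ_fin_four _ hl]
      linarith [le_max_left ‖u k‖ ‖u l‖]
  · rintro ⟨h0, h⟩
    refine ⟨h0, h.sum_le, fun i j hij => ⟨⟨?_, ?_⟩, fun k l hl => ?_⟩⟩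
    · rw [he]; linarith [h.two i j hij]
    · rw [he]; linarith [h.two j i hij.symm]
    · obtain ⟨-, h2, h3, h4, h5, -⟩ := distinct_of_univ_fin_four i j k l hl
      have a1 := h.four_min i j k hij h2 h4
      have a2 := h.four_min i j l hij h3 h5
      have a3 := h.four_max i j k hij h2 h4
      have a4 := h.four_max i j l hij h3 h5
      rw [sum_of_univ_fin_four _ hl] at a3 a4
      constructor
      · rcases min_choice (gm s t k) (gm s t l) with e | e <;> rw [e] <;> linarith
      · rcases max_choice ‖u k‖ ‖u l‖ with e | e <;> rw [e] <;> linarith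

/-! ### The dual pairing with pure states -/

/-- The real number `⟨|ξ⟩⟨ξ|, M⟩ = ∑ ξ_p ξ̄_q M_{pq}`. -/
noncomputable def form (M : Matrix Idx Idx ℂ) (ξ : Idx → ℂ) : ℝ :=
  (∑ p, ∑ q, ξ p * star (ξ q) * M p q).re

theorem pureState_mem_selfAdjoint (ξ : Idx → ℂ) :
    pureState ξ ∈ selfAdjoint (Matrix Idx Idx ℂ) := by
  rw [selfAdjoint.mem_iff, Matrix.star_eq_conjTranspose]
  ext p q
  simp [pureState, Matrix.vecMulVec_apply, mul_comm]

theorem pairing_pureState (ρ W : Herm) (ξ : Idx → ℂ) (h : (ρ : Matrix Idx Idx ℂ) = pureState ξ) :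
    pairing ρ W = form W ξ := by
  simp only [pairing, LinearMap.mk₂_apply, form, h]
  simp only [Matrix.trace, Matrix.diag_apply, Matrix.mul_apply, Matrix.transpose_apply, pureState,
    Matrix.vecMulVec_apply, Pi.star_apply]

/-- The generators alone decide membership in the dual cone of a cone of product states. -/
theorem mem_dualCone_hull {X Y : Type*} (f : X → Y → Idx → ℂ) (W : Herm) :
    W ∈ dualCone (PointedCone.hull ℝ {ρ : Herm | ∃ x y,
      (ρ : Matrix Idx Idx ℂ) = pureState (f x y)}) ↔ ∀ x y, 0 ≤ form W (f x y) := by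
  rw [dualCone, PointedCone.dual_hull, PointedCone.mem_dual]
  constructor
  · intro h x y
    rw [← pairing_pureState ⟨_, pureState_mem_selfAdjoint (f x y)⟩ W (f x y) rfl]
    exact h ⟨x, y, rfl⟩
  · rintro h ρ ⟨x, y, hρ⟩
    rw [pairing_pureState ρ W _ hρ]
    exact h x y

/-- The vector with the entries of the product `x ⊗ y` of two vectors of `ℂ²` placed at the four
positions `i`, `j` and their flips, such that flipped positions carry complementary products. -/
def crossVec (i j : Fin 4) (a b c d : ℂ) : Idx → ℂ :=
  Pi.single (lo i) (a * c) + Pi.single (flipBits (lo i)) (b * d) +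
    Pi.single (lo j) (a * d) + Pi.single (flipBits (lo j)) (b * c)

/-- The diagonal entries `s` of the `X`-part of `M`. -/
def loDiag (M : Matrix Idx Idx ℂ) (i : Fin 4) : ℝ := (M (lo i) (lo i)).re

/-- The diagonal entries `t` of the `X`-part of `M`. -/
def hiDiag (M : Matrix Idx Idx ℂ) (i : Fin 4) : ℝ := (M (flipBits (lo i)) (flipBits (lo i))).re

/-- The anti-diagonal entries `u` of the `X`-part of `M`. -/
def antiDiag (M : Matrix Idx Idx ℂ) (i : Fin 4) : ℂ := M (lo i) (flipBits (lo i))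

theorem Herm.apply_star (W : Herm) (p q : Idx) :
    star ((W : Matrix Idx Idx ℂ) p q) = (W : Matrix Idx Idx ℂ) q p :=
  congrFun (congrFun (show Matrix.conjTranspose (W : Matrix Idx Idx ℂ) = W from W.2) q) p

theorem Herm.apply_self (W : Herm) (p : Idx) :
    (((W : Matrix Idx Idx ℂ) p p).re : ℂ) = (W : Matrix Idx Idx ℂ) p p :=
  Complex.conj_eq_iff_re.mp (Herm.apply_star W p p)

/-- Averaging over the signs of `b` and `d` removes the entries outside the `X`-part. -/
theorem form_crossVec_add (W : Herm) (i j : Fin 4) (a b c d : ℂ) :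
    form W (crossVec i j a b c d) + form W (crossVec i j a (-b) c (-d)) =
      2 * (‖a * c‖ ^ 2 * loDiag W i + ‖b * d‖ ^ 2 * hiDiag W i +
        ‖a * d‖ ^ 2 * loDiag W j + ‖b * c‖ ^ 2 * hiDiag W j +
        2 * (a * c * star (b * d) * antiDiag W i + a * d * star (b * c) * antiDiag W j).re) := by
  simp only [form]
  simp only [crossVec, Pi.add_apply, star_add, add_mul, mul_add, Finset.sum_add_distrib,
    Pi.single_apply, apply_ite star, star_zero, ite_mul, mul_ite, zero_mul, mul_zero,
    Finset.sum_ite_eq', Finset.mem_univ, if_true]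
  rw [← Herm.apply_star W (lo i) (flipBits (lo i)), ← Herm.apply_star W (lo j) (flipBits (lo j)),
    ← Herm.apply_self W (lo i), ← Herm.apply_self W (lo j), ← Herm.apply_self W (flipBits (lo i)),
    ← Herm.apply_self W (flipBits (lo j))]
  simp only [← Complex.normSq_eq_norm_sq, Complex.normSq_apply, Complex.add_re,
    loDiag, hiDiag, antiDiag]
  simp
  ring

theorem form_xMatrix (s t : Fin 4 → ℝ) (u : Fin 4 → ℂ) (ξ : Idx → ℂ) :
    form (xMatrix s t u) ξ = ∑ i, (‖ξ (lo i)‖ ^ 2 * s i + ‖ξ (flipBits (lo i))‖ ^ 2 * t i +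
      2 * (ξ (lo i) * star (ξ (flipBits (lo i))) * u i).re) := by
  have h : ∑ p, ∑ q, ξ p * star (ξ q) * xMatrix s t u p q = ∑ i, (
    ξ (lo i) * star (ξ (lo i)) * s i
     + ξ (flipBits (lo i)) * star (ξ (flipBits (lo i))) * t i +
     ξ (lo i) * star (ξ (flipBits (lo i))) * u i +
     ξ (flipBits (lo i)) * star (ξ (lo i)) * star (u i)) := by
    simp only [xMatrix, Matrix.sum_apply, Finset.mul_sum]
    rw [Finset.sum_congr rfl fun p _ => Finset.sum_comm, Finset.sum_comm]
    refine Finset.sum_congr rfl fun i _ => ?_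
    simp only [Matrix.add_apply, mul_add, Finset.sum_add_distrib, Matrix.single_apply,
      mul_ite, mul_zero, ite_and]
    simp
  rw [form, h, Complex.re_sum]
  refine Finset.sum_congr rfl fun i _ => ?_
  simp [← Complex.normSq_eq_norm_sq, Complex.normSq_apply]
  ring

/-! ### Inequalities of a single dual cone -/

/-- The infimum `2√(st)` of `f² s + t / f²` is approached also when `s` or `t` vanishes, where it
need not be attained. -/
theorem exists_sq_mul_add_div_sq_le {s t ε : ℝ} (hs : 0 ≤ s) (ht : 0 ≤ t) (hε : 0 < ε) :
    ∃ f : ℝ, 0 < f ∧ f ^ 2 * s + t / f ^ 2 ≤ 2 * √(s * t) + ε := by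
  suffices ∃ P : ℝ, 0 < P ∧ P * s + t / P ≤ 2 * √(s * t) + ε by
    obtain ⟨P, hP, h⟩ := this
    exact ⟨√P, Real.sqrt_pos.2 hP, by rwa [Real.sq_sqrt hP.le]⟩
  rcases hs.eq_or_lt with rfl | hs
  · refine ⟨(t + 1) / ε, by positivity, ?_⟩
    have : t / ((t + 1) / ε) ≤ ε := by
      rw [div_le_iff₀ (by positivity)]
      field_simp
      linarith
    simpa using this
  rcases ht.eq_or_lt with rfl | ht
  · refine ⟨ε / s, by positivity, ?_⟩
    have : ε / s * s = ε := by field_simp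
    simp [this]
  · refine ⟨√t / √s, by positivity, ?_⟩
    have h1 : √t / √s * s = √s * √t := by
      nth_rw 2 [← Real.mul_self_sqrt hs.le]
      field_simp
    have h2 : t / (√t / √s) = √s * √t := by
      nth_rw 1 [← Real.mul_self_sqrt ht.le]
      field_simp
    rw [h1, h2, Real.sqrt_mul hs.le]
    linarith

/-- Two phases suffice to make two products negative at once. -/
theorem exists_phases (z w : ℂ) : ∃ e e' : ℂ, ‖e‖ = 1 ∧ ‖e'‖ = 1 ∧
    e * e' * z = -(‖z‖ : ℂ) ∧ e * star e' * w = -(‖w‖ : ℂ) := by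
  have neg : ∀ z : ℂ, Complex.exp ((Real.pi - z.arg : ℝ) * Complex.I) * z = -(‖z‖ : ℂ) := fun z => by
    conv_lhs => rw [← Complex.norm_mul_exp_arg_mul_I z]
    rw [mul_left_comm, ← Complex.exp_add]
    simp [sub_mul]
  refine ⟨Complex.exp (((Real.pi - z.arg + (Real.pi - w.arg)) / 2 : ℝ) * Complex.I),
    Complex.exp (((Real.pi - z.arg - (Real.pi - w.arg)) / 2 : ℝ) * Complex.I),
    Complex.norm_exp_ofReal_mul_I _, Complex.norm_exp_ofReal_mul_I _, ?_, ?_⟩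
  · rw [← Complex.exp_add, ← neg z]
    congr 2
    push_cast
    ring
  · rw [Complex.star_def, ← Complex.exp_conj, ← Complex.exp_add, ← neg w]
    congr 2
    rw [map_mul, Complex.conj_I, Complex.conj_ofReal]
    push_cast
    ring

/-- Nonnegativity on the product vectors supported at `i`, `j` and their flips gives `W₁[i,j]`. -/
theorem W1_of_form_nonneg (W : Herm) (i j : Fin 4)
    (H : ∀ a b c d : ℂ, 0 ≤ form W (crossVec i j a b c d)) :
    ((0 ≤ loDiag W i ∧ 0 ≤ hiDiag W i) ∧ (0 ≤ loDiag W j ∧ 0 ≤ hiDiag W j)) ∧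
      W1 (loDiag W) (hiDiag W) (antiDiag W) i j := by
  have key : ∀ a b c d : ℂ, 0 ≤ ‖a * c‖ ^ 2 * loDiag W i + ‖b * d‖ ^ 2 * hiDiag W i +
      ‖a * d‖ ^ 2 * loDiag W j + ‖b * c‖ ^ 2 * hiDiag W j +
        2 * (a * c * star (b * d) * antiDiag W i + a * d * star (b * c) * antiDiag W j).re :=
    fun a b c d => by
      linarith [form_crossVec_add W i j a b c d, H a b c d, H a (-b) c (-d)]
  have hsi : 0 ≤ loDiag W i := by simpa using key 1 0 1 0
  have hti : 0 ≤ hiDiag W i := by simpa using key 0 1 0 1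
  have hsj : 0 ≤ loDiag W j := by simpa using key 1 0 0 1
  have htj : 0 ≤ hiDiag W j := by simpa using key 0 1 1 0
  refine ⟨⟨⟨hsi, hti⟩, hsj, htj⟩, ?_⟩
  refine le_of_forall_pos_le_add fun ε hε => ?_
  obtain ⟨f, hf, hf'⟩ := exists_sq_mul_add_div_sq_le hsi hti hε
  obtain ⟨g, hg, hg'⟩ := exists_sq_mul_add_div_sq_le hsj htj hε
  obtain ⟨e, e', he, he', h1, h2⟩ := exists_phases (antiDiag W i) (antiDiag W j)
  -- The moduli make the weights of the four diagonal entries `f⁴g²`, `g²`, `f²g⁴`, `f²`, with both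
  -- anti-diagonal entries weighted by `f²g²`.
  have h := key (f * g * e) 1 (f * e') g
  have r1 : (f * g * e : ℂ) * (f * e') * star (1 * (g : ℂ)) * antiDiag W i =
      ((-(f ^ 2 * g ^ 2 * ‖antiDiag W i‖) : ℝ) : ℂ) := by
    push_cast
    rw [← mul_neg, ← h1]
    simp only [one_mul, Complex.star_def, Complex.conj_ofReal]
    ring
  have r2 : (f * g * e : ℂ) * g * star (1 * (f * e' : ℂ)) * antiDiag W j =
      ((-(f ^ 2 * g ^ 2 * ‖antiDiag W j‖) : ℝ) : ℂ) := by
    push_cast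
    rw [← mul_neg, ← h2]
    simp only [one_mul, Complex.star_def, Complex.conj_ofReal, map_mul]
    ring
  rw [r1, r2, ← Complex.ofReal_add, Complex.ofReal_re] at h
  simp only [norm_mul, he, he', norm_one, Complex.norm_real, Real.norm_of_nonneg hf.le,
    Real.norm_of_nonneg hg.le] at h
  have h' : 0 ≤ (f ^ 2 * g ^ 2) * ((f ^ 2 * loDiag W i + hiDiag W i / f ^ 2) +
      (g ^ 2 * loDiag W j + hiDiag W j / g ^ 2) -
        2 * (‖antiDiag W i‖ + ‖antiDiag W j‖)) := by
    refine h.trans_eq ?_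
    field_simp
    ring
  have h'' := nonneg_of_mul_nonneg_right h' (by positivity)
  simp only [gm]
  linarith

/-- Sufficiency of two `W₁` inequalities: by the inequality of arithmetic and geometric means the
form is at least `2 ∑ |ξ_i ξ_ī| (√(sᵢ tᵢ) - |uᵢ|)`, where `ī` is the flip of `i`, and the weights
agree on each of the two pairs. -/
theorem form_xMatrix_nonneg {s t : Fin 4 → ℝ} {u : Fin 4 → ℂ} (h0 : ∀ i, 0 ≤ s i ∧ 0 ≤ t i)
    {i j k l : Fin 4} (hu : ({i, j, k, l} : Finset (Fin 4)) = Finset.univ)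
    (hij : W1 s t u i j) (hkl : W1 s t u k l) {ξ : Idx → ℂ}
    (eij : ‖ξ (lo i) * ξ (flipBits (lo i))‖ = ‖ξ (lo j) * ξ (flipBits (lo j))‖)
    (ekl : ‖ξ (lo k) * ξ (flipBits (lo k))‖ = ‖ξ (lo l) * ξ (flipBits (lo l))‖) :
    0 ≤ form (xMatrix s t u) ξ := by
  have term : ∀ i, 2 * (‖ξ (lo i) * ξ (flipBits (lo i))‖ * (gm s t i - ‖u i‖)) ≤
      ‖ξ (lo i)‖ ^ 2 * s i + ‖ξ (flipBits (lo i))‖ ^ 2 * t i +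
      2 * (ξ (lo i) * star (ξ (flipBits (lo i))) * u i).re := fun i => by
    have h1 : -(‖ξ (lo i)‖ * ‖ξ (flipBits (lo i))‖ * ‖u i‖) ≤
        (ξ (lo i) * star (ξ (flipBits (lo i))) * u i).re := by
      have := (abs_le.1 (Complex.abs_re_le_norm (ξ (lo i) * star (ξ (flipBits (lo i))) * u i))).1
      rwa [norm_mul, norm_mul, norm_star] at this
    have h2 := sq_nonneg (‖ξ (lo i)‖ * √(s i) - ‖ξ (flipBits (lo i))‖ * √(t i))
    rw [sub_sq, mul_pow, mul_pow, Real.sq_sqrt (h0 i).1, Real.sq_sqrt (h0 i).2] at h2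
    rw [gm, Real.sqrt_mul (h0 i).1, norm_mul]
    linarith
  rw [form_xMatrix]
  refine le_trans ?_ (Finset.sum_le_sum fun i _ => term i)
  rw [sum_of_univ_fin_four _ hu, eij, ekl]
  have a1 := mul_nonneg (norm_nonneg (ξ (lo j) * ξ (flipBits (lo j)))) (sub_nonneg.2 hij)
  have a2 := mul_nonneg (norm_nonneg (ξ (lo l) * ξ (flipBits (lo l)))) (sub_nonneg.2 hkl)
  linarith

/-! ### The three dual cones -/

/-- The cone `K` of self-adjoint matrices has the inequalities of the pairs `{i, j}` and `{k, l}`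
as necessary conditions on the `X`-part of its elements, and they are sufficient for `X`-shaped
matrices. -/
structure DetectedByPairs (K : PointedCone ℝ Herm) (i j k l : Fin 4) : Prop where
  ineqs : ∀ W : Herm, W ∈ K → (∀ m, 0 ≤ loDiag W m ∧ 0 ≤ hiDiag W m) ∧
    W1 (loDiag W) (hiDiag W) (antiDiag W) i j ∧ W1 (loDiag W) (hiDiag W) (antiDiag W) k l
  mem : ∀ (W : Herm) (s t : Fin 4 → ℝ) (u : Fin 4 → ℂ), (W : Matrix Idx Idx ℂ) = xMatrix s t u →
    (∀ m, 0 ≤ s m ∧ 0 ≤ t m) → W1 s t u i j → W1 s t u k l → W ∈ K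

/-- For product vectors of a bipartition, `ξ_i ξ_ī` depends only on the pair containing `i`, and all
vectors `crossVec` of the two pairs are products. These two facts determine the inequalities. -/
theorem detectedByPairs_dualCone_hull {X Y : Type*} (f : X → Y → Idx → ℂ) {i j k l : Fin 4}
    (hu : ({i, j, k, l} : Finset (Fin 4)) = Finset.univ)
    (hij : ∀ a b c d, ∃ x y, f x y = crossVec i j a b c d)
    (hkl : ∀ a b c d, ∃ x y, f x y = crossVec k l a b c d)
    (eij : ∀ x y, f x y (lo i) * f x y (flipBits (lo i)) = f x y (lo j) * f x y (flipBits (lo j)))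
    (ekl : ∀ x y, f x y (lo k) * f x y (flipBits (lo k)) = f x y (lo l) * f x y (flipBits (lo l))) :
    DetectedByPairs (dualCone (PointedCone.hull ℝ {ρ : Herm | ∃ x y,
      (ρ : Matrix Idx Idx ℂ) = pureState (f x y)})) i j k l where
  ineqs W hW := by
    rw [mem_dualCone_hull] at hW
    obtain ⟨⟨hi, hj⟩, hij'⟩ := W1_of_form_nonneg W i j fun a b c d => by
      obtain ⟨x, y, h⟩ := hij a b c d
      exact h ▸ hW x y
    obtain ⟨⟨hk, hl⟩, hkl'⟩ := W1_of_form_nonneg W k l fun a b c d => by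
      obtain ⟨x, y, h⟩ := hkl a b c d
      exact h ▸ hW x y
    refine ⟨fun m => ?_, hij', hkl'⟩
    have hm : m ∈ ({i, j, k, l} : Finset (Fin 4)) := hu ▸ Finset.mem_univ m
    simp only [Finset.mem_insert, Finset.mem_singleton] at hm
    rcases hm with rfl | rfl | rfl | rfl <;> assumption
  mem W s t u hW h0 h1 h2 := by
    rw [mem_dualCone_hull]
    intro x y
    rw [hW]
    exact form_xMatrix_nonneg h0 hu h1 h2 (congrArg _ (eij x y)) (congrArg _ (ekl x y))

theorem detectedByPairs_dualCone_coneA : DetectedByPairs (dualCone coneA) 0 3 1 2 := by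
  refine detectedByPairs_dualCone_hull
    (fun (x : Fin 2 → ℂ) (y : Fin 2 × Fin 2 → ℂ) p => x p.1 * y (p.2.1, p.2.2))
    (by decide) (fun a b c d => ⟨![a, b], Pi.single (0, 0) c + Pi.single (1, 1) d, ?_⟩)
    (fun a b c d => ⟨![a, b], Pi.single (0, 1) c + Pi.single (1, 0) d, ?_⟩)
    (fun x y => ?_) (fun x y => ?_)
  · ext ⟨p, q, r⟩
    fin_cases p <;> fin_cases q <;> fin_cases r <;> simp [crossVec, lo, flipBits]
  · ext ⟨p, q, r⟩
    fin_cases p <;> fin_cases q <;> fin_cases r <;> simp [crossVec, lo, flipBits]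
  · simp [lo, flipBits]; ring
  · simp [lo, flipBits]; ring

theorem detectedByPairs_dualCone_coneB : DetectedByPairs (dualCone coneB) 0 2 1 3 := by
  refine detectedByPairs_dualCone_hull
    (fun (x : Fin 2 → ℂ) (y : Fin 2 × Fin 2 → ℂ) p => x p.2.1 * y (p.2.2, p.1))
    (by decide) (fun a b c d => ⟨![c, d], Pi.single (0, 0) a + Pi.single (1, 1) b, ?_⟩)
    (fun a b c d => ⟨![c, d], Pi.single (1, 0) a + Pi.single (0, 1) b, ?_⟩)
    (fun x y => ?_) (fun x y => ?_)
  · ext ⟨p, q, r⟩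
    fin_cases p <;> fin_cases q <;> fin_cases r <;> simp [crossVec, lo, flipBits, mul_comm]
  · ext ⟨p, q, r⟩
    fin_cases p <;> fin_cases q <;> fin_cases r <;> simp [crossVec, lo, flipBits, mul_comm]
  · simp [lo, flipBits]; ring
  · simp [lo, flipBits]; ring

theorem detectedByPairs_dualCone_coneC : DetectedByPairs (dualCone coneC) 0 1 2 3 := by
  refine detectedByPairs_dualCone_hull
    (fun (x : Fin 2 → ℂ) (y : Fin 2 × Fin 2 → ℂ) p => x p.2.2 * y (p.1, p.2.1))
    (by decide) (fun a b c d => ⟨![c, d], Pi.single (0, 0) a + Pi.single (1, 1) b, ?_⟩)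
    (fun a b c d => ⟨![c, d], Pi.single (0, 1) a + Pi.single (1, 0) b, ?_⟩)
    (fun x y => ?_) (fun x y => ?_)
  · ext ⟨p, q, r⟩
    fin_cases p <;> fin_cases q <;> fin_cases r <;> simp [crossVec, lo, flipBits, mul_comm]
  · ext ⟨p, q, r⟩
    fin_cases p <;> fin_cases q <;> fin_cases r <;> simp [crossVec, lo, flipBits, mul_comm]
  · simp [lo, flipBits]; ring
  · simp [lo, flipBits]; ring

/-! ### Splitting of `X`-shaped matrices -/

theorem xMatrix_apply_lo (s t : Fin 4 → ℝ) (u : Fin 4 → ℂ) (i : Fin 4) :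
    xMatrix s t u (lo i) (lo i) = s i ∧ xMatrix s t u (lo i) (flipBits (lo i)) = u i ∧
      xMatrix s t u (flipBits (lo i)) (flipBits (lo i)) = t i := by
  fin_cases i <;>
    simp [xMatrix, lo, flipBits, Fin.sum_univ_four]

theorem eq_diag_of_xPart_eq {M : Matrix Idx Idx ℂ} {s t : Fin 4 → ℝ} {u : Fin 4 → ℂ}
    (h : xPart M = xMatrix s t u) : s = loDiag M ∧ t = hiDiag M ∧ u = antiDiag M := by
  refine ⟨funext fun i => ?_, funext fun i => ?_, funext fun i => ?_⟩
  · rw [loDiag, ← Complex.ofReal_re (s i), ← (xMatrix_apply_lo s t u i).1, ← h]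
    simp [xPart]
  · rw [hiDiag, ← Complex.ofReal_re (t i), ← (xMatrix_apply_lo s t u i).2.2, ← h]
    simp [xPart]
  · rw [antiDiag, ← (xMatrix_apply_lo s t u i).2.1, ← h]
    simp [xPart]

theorem xPart_eq_self {M : Matrix Idx Idx ℂ} (h : IsXShaped M) : xPart M = M := by
  ext p q
  by_cases h1 : q = p ∨ q = flipBits p
  · simp [xPart, h1]
  · rw [not_or] at h1
    simp [xPart, h1.1, h1.2, h p q h1.1 h1.2]

theorem xMatrix_mem_selfAdjoint (s t : Fin 4 → ℝ) (u : Fin 4 → ℂ) :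
    xMatrix s t u ∈ selfAdjoint (Matrix Idx Idx ℂ) := by
  rw [selfAdjoint.mem_iff, xMatrix, star_sum]
  refine Finset.sum_congr rfl fun i _ => ?_
  simp only [star_add, Matrix.star_eq_conjTranspose, Matrix.conjTranspose_single, star_star,
    show star ((s i : ℝ) : ℂ) = s i from Complex.conj_ofReal _,
    show star ((t i : ℝ) : ℂ) = t i from Complex.conj_ofReal _]
  abel

theorem xMatrix_add (s t s' t' : Fin 4 → ℝ) (u u' : Fin 4 → ℂ) :
    xMatrix (s + s') (t + t') (u + u') = xMatrix s t u + xMatrix s' t' u' := by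
  simp only [xMatrix, ← Finset.sum_add_distrib]
  refine Finset.sum_congr rfl fun i _ => ?_
  simp only [Pi.add_apply, Complex.ofReal_add, star_add, Matrix.single_add]
  abel

theorem sqrt_mul_add_sqrt_mul_le {a b c d : ℝ} (ha : 0 ≤ a) (hb : 0 ≤ b) (hc : 0 ≤ c)
    (hd : 0 ≤ d) : √(a * b) + √(c * d) ≤ √((a + c) * (b + d)) := by
  refine Real.le_sqrt_of_sq_le ?_
  have h := sq_nonneg (√a * √d - √c * √b)
  rw [Real.sqrt_mul ha, Real.sqrt_mul hc]
  nlinarith [Real.sq_sqrt ha, Real.sq_sqrt hb, Real.sq_sqrt hc, Real.sq_sqrt hd]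

/-- The factor exists also for `y = 0`, where `x = 0`. -/
theorem exists_factor {x y : ℝ} (hx : 0 ≤ x) (hxy : x ≤ y) :
    ∃ r : ℝ, 0 ≤ r ∧ r ≤ 1 ∧ x = r * y := by
  rcases (hx.trans hxy).eq_or_lt with h | h
  · exact ⟨0, le_rfl, zero_le_one, by linarith⟩
  · exact ⟨x / y, by positivity, (div_le_one h).2 hxy, by field_simp⟩

theorem gm_mul {r s t : Fin 4 → ℝ} (hr : ∀ i, 0 ≤ r i) : gm (r * s) (r * t) = r * gm s t := by
  ext i
  simp only [gm, Pi.mul_apply]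
  rw [show r i * s i * (r i * t i) = r i * r i * (s i * t i) by ring,
    Real.sqrt_mul (mul_self_nonneg _), Real.sqrt_mul_self (hr i)]

/-! ### Sums of two intersections of dual cones -/

section

variable {K₁ K₂ K₃ : PointedCone ℝ Herm} {σ : Equiv.Perm (Fin 4)}

theorem ineqs_of_mem_sup (h₁ : DetectedByPairs K₁ (σ 0) (σ 3) (σ 1) (σ 2))
    (h₂ : DetectedByPairs K₂ (σ 0) (σ 2) (σ 1) (σ 3))
    (h₃ : DetectedByPairs K₃ (σ 0) (σ 1) (σ 2) (σ 3)) {W : Herm}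
    (hW : W ∈ (K₁ ⊓ K₂) ⊔ (K₁ ⊓ K₃)) :
    CommonIneqs (loDiag W) (hiDiag W) (antiDiag W) ∧
      W1 (loDiag W) (hiDiag W) (antiDiag W) (σ 0) (σ 3) ∧
      W1 (loDiag W) (hiDiag W) (antiDiag W) (σ 1) (σ 2) := by
  obtain ⟨V, hV, V', hV', rfl⟩ := Submodule.mem_sup.1 hW
  obtain ⟨h0, a1, a2⟩ := h₁.ineqs V hV.1
  obtain ⟨-, a3, a4⟩ := h₂.ineqs V hV.2
  obtain ⟨h0', b1, b2⟩ := h₁.ineqs V' hV'.1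
  obtain ⟨-, b3, b4⟩ := h₃.ineqs V' hV'.2
  have es : loDiag ↑(V + V') = loDiag V + loDiag V' := by ext i; simp [loDiag]
  have et : hiDiag ↑(V + V') = hiDiag V + hiDiag V' := by ext i; simp [hiDiag]
  have eu : antiDiag ↑(V + V') = antiDiag V + antiDiag V' := by ext i; simp [antiDiag]
  rw [es, et, eu]
  obtain ⟨c1, c2, c3⟩ := splitIneqs_of_add (m := gm (loDiag V + loDiag V') (hiDiag V + hiDiag V'))
    (n := fun i => ‖(antiDiag V + antiDiag V') i‖) σ (fun i => norm_nonneg _)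
    (fun i => Real.sqrt_nonneg _) (fun i => norm_nonneg _)
    (fun i => Real.sqrt_nonneg _) (fun i => norm_nonneg _)
    (fun i => sqrt_mul_add_sqrt_mul_le (h0 i).1 (h0 i).2 (h0' i).1 (h0' i).2)
    (fun i => norm_add_le _ _) a1 a2 a3 a4 b1 b2 b3 b4
  refine ⟨(commonIneqs_iff _ _ _).2 ⟨fun i => ?_, c1⟩, c2, c3⟩
  exact ⟨add_nonneg (h0 i).1 (h0' i).1, add_nonneg (h0 i).2 (h0' i).2⟩

theorem mem_sup_of_ineqs (h₁ : DetectedByPairs K₁ (σ 0) (σ 3) (σ 1) (σ 2))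
    (h₂ : DetectedByPairs K₂ (σ 0) (σ 2) (σ 1) (σ 3))
    (h₃ : DetectedByPairs K₃ (σ 0) (σ 1) (σ 2) (σ 3)) {W : Herm}
    {s t : Fin 4 → ℝ} {u : Fin 4 → ℂ} (hW : (W : Matrix Idx Idx ℂ) = xMatrix s t u)
    (hc : CommonIneqs s t u) (h03 : W1 s t u (σ 0) (σ 3)) (h12 : W1 s t u (σ 1) (σ 2)) :
    W ∈ (K₁ ⊓ K₂) ⊔ (K₁ ⊓ K₃) := by
  obtain ⟨h0, hc⟩ := (commonIneqs_iff s t u).1 hc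
  obtain ⟨p, q, hp, hq, ⟨a1, a2⟩, ⟨a3, a4⟩, ⟨b1, b2⟩, b3, b4⟩ := PairLE.split hc σ h03 h12
  -- The diagonal is split by factors with `p = r m`, the anti-diagonal by factors with `q = r' n`.
  choose r hr0 hr1 hr using fun i => exists_factor (hp i).1 (hp i).2
  choose r' hr0' hr1' hr' using fun i => exists_factor (hq i).1 (hq i).2
  have hr2 : ∀ i, 0 ≤ (1 - r) i := fun i => sub_nonneg.2 (hr1 i)
  have ep : p = gm (r * s) (r * t) := by
    rw [gm_mul hr0]; exact funext hr
  have ep' : gm s t - p = gm ((1 - r) * s) ((1 - r) * t) := by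
    rw [gm_mul hr2, sub_mul, one_mul]; exact congrArg _ (funext hr)
  have eq : q = fun i => ‖(r' i : ℂ) * u i‖ := by
    funext i
    rw [norm_mul, Complex.norm_real, Real.norm_of_nonneg (hr0' i)]
    exact hr' i
  have eq' : (fun i => ‖u i‖) - q = fun i => ‖((1 - r' i : ℝ) : ℂ) * u i‖ := by
    funext i
    rw [norm_mul, Complex.norm_real, Real.norm_of_nonneg (sub_nonneg.2 (hr1' i)), sub_mul, one_mul, ← hr' i]
    rfl
  rw [ep', eq'] at b1 b2 b3 b4
  rw [ep, eq] at a1 a2 a3 a4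
  have n1 : ∀ i, 0 ≤ (r * s) i ∧ 0 ≤ (r * t) i := fun i =>
    ⟨mul_nonneg (hr0 i) (h0 i).1, mul_nonneg (hr0 i) (h0 i).2⟩
  have n2 : ∀ i, 0 ≤ ((1 - r) * s) i ∧ 0 ≤ ((1 - r) * t) i := fun i =>
    ⟨mul_nonneg (hr2 i) (h0 i).1, mul_nonneg (hr2 i) (h0 i).2⟩
  let V : Herm := ⟨xMatrix (r * s) (r * t) (fun i => r' i * u i), xMatrix_mem_selfAdjoint _ _ _⟩
  let V' : Herm := ⟨xMatrix ((1 - r) * s) ((1 - r) * t) (fun i => ((1 - r' i : ℝ) : ℂ) * u i),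
    xMatrix_mem_selfAdjoint _ _ _⟩
  have hV : V ∈ K₁ ⊓ K₂ := Submodule.mem_inf.2
    ⟨h₁.mem V (r * s) (r * t) (fun i => r' i * u i) rfl n1 a1 a2,
      h₂.mem V (r * s) (r * t) (fun i => r' i * u i) rfl n1 a3 a4⟩
  have hV' : V' ∈ K₁ ⊓ K₃ := Submodule.mem_inf.2
    ⟨h₁.mem V' ((1 - r) * s) ((1 - r) * t) (fun i => ((1 - r' i : ℝ) : ℂ) * u i) rfl n2 b1 b2,
      h₃.mem V' ((1 - r) * s) ((1 - r) * t) (fun i => ((1 - r' i : ℝ) : ℂ) * u i) rfl n2 b3 b4⟩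
  have hsum : W = V + V' := by
    refine Subtype.ext ?_
    rw [hW, AddSubgroup.coe_add, ← xMatrix_add]
    congr 1
    · ring
    · ring
    · funext i
      simp only [Pi.add_apply]
      push_cast
      ring
  rw [hsum]
  exact Submodule.add_mem_sup hV hV'

end

theorem W1.symm {s t : Fin 4 → ℝ} {u : Fin 4 → ℂ} {i j : Fin 4} (h : W1 s t u i j) :
    W1 s t u j i := by
  simp only [W1] at *
  linarith

theorem DetectedByPairs.symm_right {K : PointedCone ℝ Herm} {i j k l : Fin 4}
    (h : DetectedByPairs K i j k l) : DetectedByPairs K i j l k where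
  ineqs W hW := ⟨(h.ineqs W hW).1, (h.ineqs W hW).2.1, (h.ineqs W hW).2.2.symm⟩
  mem W s t u hW h0 h1 h2 := h.mem W s t u hW h0 h1 h2.symm

/-- The permutation of `{0, 1, 2, 3}` with values `0, 3, 1, 2`. It permutes cyclically the three
partitions `{03, 12}`, `{02, 13}`, `{01, 23}` that belong to `α`, `β`, `γ`. -/
def rotate : Equiv.Perm (Fin 4) where
  toFun := ![0, 3, 1, 2]
  invFun := ![0, 2, 3, 1]
  left_inv := by decide
  right_inv := by decide

end ThreeQubit

open ThreeQubit in
theorem theorem5p1 (W : selfAdjoint (Matrix Idx Idx ℂ))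
    (s t : Fin 4 → ℝ) (u : Fin 4 → ℂ)
    (hX : xPart (W : Matrix Idx Idx ℂ) = xMatrix s t u) :
    ((W ∈ (dualCone coneA ⊓ dualCone coneB) ⊔ (dualCone coneA ⊓ dualCone coneC) → CritA s t u) ∧
      (W ∈ (dualCone coneB ⊓ dualCone coneC) ⊔ (dualCone coneB ⊓ dualCone coneA) → CritB s t u) ∧
      (W ∈ (dualCone coneC ⊓ dualCone coneA) ⊔ (dualCone coneC ⊓ dualCone coneB) → CritC s t u)) ∧
    (IsXShaped (W : Matrix Idx Idx ℂ) →
      (CritA s t u →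
        W ∈ (dualCone coneA ⊓ dualCone coneB) ⊔ (dualCone coneA ⊓ dualCone coneC)) ∧
      (CritB s t u →
        W ∈ (dualCone coneB ⊓ dualCone coneC) ⊔ (dualCone coneB ⊓ dualCone coneA)) ∧
      (CritC s t u →
        W ∈ (dualCone coneC ⊓ dualCone coneA) ⊔ (dualCone coneC ⊓ dualCone coneB))) := by
  have hA := detectedByPairs_dualCone_coneA
  have hB := detectedByPairs_dualCone_coneB
  have hC := detectedByPairs_dualCone_coneC
  obtain ⟨rfl, rfl, rfl⟩ := eq_diag_of_xPart_eq hX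
  refine ⟨⟨fun h => ?_, fun h => ?_, fun h => ?_⟩,
    fun hW => ⟨fun h => ?_, fun h => ?_, fun h => ?_⟩⟩
  · exact ineqs_of_mem_sup (σ := 1) hA hB hC h
  · obtain ⟨h1, h2, h3⟩ := ineqs_of_mem_sup (σ := rotate) hB.symm_right hC.symm_right hA h
    exact ⟨h1, h2, h3.symm⟩
  · obtain ⟨h1, h2, h3⟩ := ineqs_of_mem_sup (σ := rotate⁻¹) hC hA.symm_right hB.symm_right h
    exact ⟨h1, h2, h3⟩
  all_goals rw [xPart_eq_self hW] at hX
  · exact mem_sup_of_ineqs (σ := 1) hA hB hC hX h.1 h.2.1 h.2.2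
  · exact mem_sup_of_ineqs (σ := rotate) hB.symm_right hC.symm_right hA hX h.1 h.2.1 h.2.2.symm
  · exact mem_sup_of_ineqs (σ := rotate⁻¹) hC hA.symm_right hB.symm_right hX h.1 h.2.1 h.2.2
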